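/- All topological groups and paratopological groups are Hausdorff. A paratopological group is a group with a topology for which the multiplication is (jointly) continuous; it is a topological group if the inversion is continuous as well. A paratopological group $G$ is H-closed if it is closed in every Hausdorff paratopological group that contains $G$ as a subgroup carrying the subspace topology. A topological group is monothetic if it has a dense cyclic subgroup; it is precompact if for every neighborhood $U$ of the unit there is a finite subset $K$ of the group such that $KU$ is the whole group; and it is Rajkov complete if it is complete with respect to its upper uniformity, the least upper bound of the left and the right uniformities. **Proposition.** Let $G$ be an H-closed abelian topological group. Then $G$ is a union of compact subgroups. Moreover, every closed monothetic subgroup of $G$ is precompact and Rajkov complete, and hence compact. -/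

import Mathlib

open scoped Pointwise Topology

universe u

/-- A (Hausdorff) paratopological group `G` is H-closed if it is closed in every Hausdorff
paratopological group `H` containing it as a subgroup with the subspace topology, i.e. if every
homomorphism from `G` to `H` which is a topological embedding has closed range. -/
def IsHClosedGroup (G : Type u) [Group G] [TopologicalSpace G] [ContinuousMul G] [T2Space G] :
    Prop :=
  ∀ (H : Type u) [Group H] [TopologicalSpace H] [ContinuousMul H] [T2Space H] (f : G →* H),
    Topology.IsEmbedding f → IsClosed (Set.range f)

/-- A topological group is monothetic if some cyclic subgroup is dense. -/
def IsMonotheticGroup (G : Type*) [Group G] [TopologicalSpace G] [IsTopologicalGroup G] : Prop :=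
  ∃ x : G, Dense (Subgroup.zpowers x : Set G)

/-- A topological group is precompact if for every neighborhood `U` of the unit it is covered by
finitely many translates of `U`. -/
def IsPrecompactGroup (G : Type*) [Group G] [TopologicalSpace G] [IsTopologicalGroup G] : Prop :=
  ∀ U ∈ 𝓝 (1 : G), ∃ K : Set G, K.Finite ∧ K * U = Set.univ

/-- The upper uniformity: the coarsest uniformity finer than both the left and the right one.
In Mathlib's order on uniformities (finer is smaller) this is the infimum `⊓`. -/
abbrev upperUniformSpace (G : Type*) [Group G] [TopologicalSpace G] [IsTopologicalGroup G] :
    UniformSpace G :=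
  IsTopologicalGroup.leftUniformSpace G ⊓ IsTopologicalGroup.rightUniformSpace G

/-- A topological group is Rajkov complete if it is complete in its upper uniformity. -/
def IsRajkovCompleteGroup (G : Type*) [Group G] [TopologicalSpace G] [IsTopologicalGroup G] :
    Prop :=
  @CompleteSpace G (upperUniformSpace G)

/-!
Everything reduces to the compactness of the closure of a cyclic subgroup `⟨x⟩` of `G`. An H-closed
group is closed in its completion, hence complete, so it is enough that `⟨x⟩` is totally bounded.

Suppose that `⟨x⟩` is not totally bounded. Then for some neighborhood `U` of the unit the set
`T = {n : ℤ | x ^ n ∈ U}` is *sparse*: finitely many translates of `(T - T) - (T - T)` do not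
cover `ℤ`. A covering argument in the spirit of B. H. Neumann (`exists_finite_add_sub_eq_univ`)
produces, for given finite `F` and `N`, an integer `b` such that no `m * b` with `0 < |m| ≤ N` lies
in `F + T`. Iterating yields a sequence `b i` which is *dissociated*: combinations of the `b i` with
slowly growing coefficients avoid `T` unless they are trivial (`IsSparse.exists_isDissociated`).

On `G × ℤ` consider the group topology, coarser than that of `G` on the first factor, which makes
`(x ^ b i, 1)` converge to the unit. Dissociation guarantees that it is Hausdorff
(`IntExtension.t2Space_sequenceBasis`), and `(1, -1)`, being the limit of `(x ^ b i, 0)`, lies in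
the closure of `G`. Intersecting this topology with the lexicographic topology, in which
neighborhoods of `(g, n)` contain `G × {m}` for all `m > n`, gives back the original topology on `G`
and does not separate `(1, -1)` from `G`. Inversion is no longer continuous, but multiplication is,
so `G` is a nonclosed subgroup of a Hausdorff paratopological group
(`IsHClosedGroup.notMem_closure_range_inl`), a contradiction.
-/

/-! ### Covering arguments and dissociated sequences of integers -/

/-- If finitely many families of finitely many translates cover an abelian group, then the
difference set of one of the translated sets has finitely many translates covering the group. -/
theorem exists_finite_add_sub_eq_univ {A ι : Type*} [AddCommGroup A] (s : Finset ι)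
    (Q : ι → Set A) (F : ι → Set A) (hF : ∀ i, (F i).Finite)
    (hcov : ∀ a, ∃ i ∈ s, a ∈ F i + Q i) :
    ∃ i ∈ s, ∃ K : Set A, K.Finite ∧ K + (Q i - Q i) = Set.univ := by
  classical
  induction s using Finset.induction_on generalizing F with
  | empty => simpa using hcov 0
  | insert j s hj ih =>
    by_cases hK : (F j - F j) + (Q j - Q j) = Set.univ
    · exact ⟨j, Finset.mem_insert_self _ _, _, (hF j).sub (hF j), hK⟩
    -- A translate of `F j + Q j` disjoint from `F j + Q j` is covered by the other families.
    obtain ⟨t, ht⟩ := (Set.ne_univ_iff_exists_notMem _).1 hK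
    obtain ⟨i, hi, K, hKf, hKu⟩ := ih (fun i => F i ∪ (F i - {t}))
      (fun i => (hF i).union ((hF i).sub (Set.finite_singleton t))) (fun a => by
        obtain ⟨i, hi, hai⟩ := hcov a
        rcases Finset.mem_insert.1 hi with rfl | hi
        · obtain ⟨i', hi', hat⟩ := hcov (a + t)
          obtain ⟨f, hf, q, hq, rfl⟩ := hai
          obtain ⟨f', hf', q', hq', h⟩ := hat
          simp only at h
          rcases Finset.mem_insert.1 hi' with rfl | hi'
          · refine absurd ⟨f' - f, ⟨f', hf', f, hf, rfl⟩, q' - q, ⟨q', hq', q, hq, rfl⟩, ?_⟩ ht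
            simp only
            rw [show f' - f + (q' - q) = f' + q' - (f + q) by abel, h]
            abel
          · refine ⟨i', hi', f' - t, Or.inr ⟨f', hf', t, rfl, rfl⟩, q', hq', ?_⟩
            simp only
            rw [show f' - t + q' = f' + q' - t by abel, h]
            abel
        · obtain ⟨f, hf, q, hq, rfl⟩ := hai
          exact ⟨i, hi, f, Or.inl hf, q, hq, rfl⟩)
    exact ⟨i, Finset.mem_insert_of_mem hi, K, hKf, hKu⟩

/-- A set of integers is `IsSparse` if finitely many translates of `(T - T) - (T - T)`
never cover the integers. -/
def IsSparse (T : Set ℤ) : Prop :=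
  ∀ K : Set ℤ, K.Finite → K + ((T - T) - (T - T)) ≠ Set.univ

/-- For sparse `T`, some integer has all its small nonzero multiples outside finitely many
translates of `T`. -/
theorem IsSparse.exists_forall_mul_notMem {T : Set ℤ} (hT : IsSparse T) (F : Finset ℤ) (N : ℕ) :
    ∃ b : ℤ, ∀ m : ℤ, m ≠ 0 → |m| ≤ N → ∀ f ∈ F, m * b - f ∉ T := by
  classical
  by_contra! hcon
  let s : Finset (ℤ × ℤ) := ((Finset.Icc (-(N : ℤ)) N).erase 0) ×ˢ F
  let P : ℤ × ℤ → Set ℤ := fun p => {b | p.1 * b - p.2 ∈ T}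
  -- Each `P (m, f)` lies in a single translate of `{q | m * q ∈ T - T}`.
  let Q : ℤ × ℤ → Set ℤ := fun p => {q | p.1 * q ∈ T - T}
  have hP : ∀ p, ∃ c, P p ⊆ {c} + Q p := fun p => by
    rcases (P p).eq_empty_or_nonempty with h | ⟨c, hc⟩
    · exact ⟨0, h ▸ Set.empty_subset _⟩
    · refine ⟨c, fun b hb => ⟨c, rfl, b - c, ⟨_, hb, _, hc, ?_⟩, by simp⟩⟩
      simp only
      ring
  choose c hc using hP
  obtain ⟨⟨m, f⟩, hp, K, hK, hKu⟩ := exists_finite_add_sub_eq_univ s Q (fun p => {c p})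
    (fun _ => Set.finite_singleton _) (fun b => by
      obtain ⟨m, hm, hmN, f, hf, hb⟩ := hcon b
      exact ⟨(m, f), by simp [s, hm, abs_le.1 hmN, hf], hc _ hb⟩)
  have hm : m ≠ 0 := by
    simp only [s, Finset.mem_product, Finset.mem_erase] at hp
    exact hp.1.1
  -- Residues modulo `m` extend the covering of `m * ℤ` to all of `ℤ`.
  refine hT ((fun k => m * k) '' K + Set.Ico 0 |m|) ((hK.image _).add (Set.finite_Ico _ _))
    (Set.eq_univ_of_forall fun n => ?_)
  have hn : n / m ∈ K + (Q (m, f) - Q (m, f)) := hKu ▸ Set.mem_univ _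
  obtain ⟨k, hk, _, ⟨q, hq, q', hq', rfl⟩, hkq⟩ := hn
  refine ⟨m * k + n % m, ⟨m * k, ⟨k, hk, rfl⟩, n % m,
    ⟨Int.emod_nonneg _ hm, Int.emod_lt_abs _ hm⟩, rfl⟩, m * q - m * q', ⟨_, hq, _, hq', rfl⟩, ?_⟩
  simp only at hkq ⊢
  linear_combination m * hkq + Int.mul_ediv_add_emod n m

/-- A sequence of integers such that no nonzero combination whose `i`-th coefficient is at most
`2 * i` in absolute value lies in `T`. -/
def IsDissociated (b : ℕ → ℤ) (T : Set ℤ) : Prop :=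
  ∀ m : ℕ →₀ ℤ, (∀ i, |m i| ≤ 2 * i) → Finsupp.linearCombination ℤ b m ∈ T → m = 0

/-- Each term is chosen by `IsSparse.exists_forall_mul_notMem` so as to avoid the finitely many
combinations of the earlier terms. -/
theorem IsSparse.exists_isDissociated {T : Set ℤ} (hT : IsSparse T) :
    ∃ b : ℕ → ℤ, IsDissociated b T := by
  classical
  choose g hg using hT.exists_forall_mul_notMem
  -- `F i` collects the values of the admissible combinations of the terms before the `i`-th.
  let F : ℕ → Finset ℤ := fun i => Nat.rec {0} (fun i Fi =>
    (Fi ×ˢ Finset.Icc (-(2 * i : ℤ)) (2 * i)).image fun p => p.1 + p.2 * g Fi (2 * i)) i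
  let b : ℕ → ℤ := fun i => g (F i) (2 * i)
  have hF : ∀ i, ∀ m : ℕ →₀ ℤ, (∀ j, |m j| ≤ 2 * j) → (∀ j, i ≤ j → m j = 0) →
      Finsupp.linearCombination ℤ b m ∈ F i := by
    intro i
    induction i with
    | zero =>
      intro m _ hm
      have : m = 0 := Finsupp.ext fun j => hm j (Nat.zero_le j)
      simp [this, F]
    | succ i ih =>
      intro m hb hm
      refine Finset.mem_image.2 ⟨(Finsupp.linearCombination ℤ b (m.erase i), m i),
        Finset.mem_product.2 ⟨ih _ (fun j => ?_) (fun j hj => ?_), ?_⟩, ?_⟩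
      · by_cases h : j = i
        · simp [h]
        · simpa [Finsupp.erase_ne h] using hb j
      · by_cases h : j = i
        · simp [h]
        · simpa [Finsupp.erase_ne h] using hm j (by omega)
      · simpa [abs_le] using hb i
      · conv_rhs => rw [← Finsupp.erase_add_single i m, map_add, Finsupp.linearCombination_single]
        rfl
  refine ⟨b, fun m hb hmT => by_contra fun hm => ?_⟩
  have hne : m.support.Nonempty := Finsupp.support_nonempty_iff.2 hm
  set i := m.support.max' hne
  have hmi : m i ≠ 0 := Finsupp.mem_support_iff.1 (Finset.max'_mem _ hne)
  refine hg (F i) (2 * i) (m i) hmi (by exact_mod_cast hb i)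
    (Finsupp.linearCombination ℤ b (-(m.erase i))) (hF i _ (fun j => ?_) (fun j hj => ?_)) ?_
  · by_cases h : j = i
    · simp [h]
    · simpa [Finsupp.erase_ne h] using hb j
  · by_cases h : j = i
    · simp [h]
    · have : j ∉ m.support := fun hj' => h (le_antisymm (Finset.le_max' _ _ hj') hj)
      simpa [Finsupp.erase_ne h] using this
  · convert hmT using 1
    conv_rhs => rw [← Finsupp.erase_add_single i m, map_add, Finsupp.linearCombination_single]
    rw [map_neg, smul_eq_mul]
    ring

/-! ### The lexicographic topology on `G × ℤ` -/

/-- The group `G × ℤ`, written multiplicatively and carrying no topology. -/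
def IntExtension (G : Type*) : Type _ := G × Multiplicative ℤ

namespace IntExtension

/-- The integer part of an element of `G × ℤ`. -/
def height {G : Type*} (p : IntExtension G) : ℤ := p.2.toAdd

@[ext] theorem ext {G : Type*} {p q : IntExtension G} (h₁ : p.1 = q.1)
    (h₂ : p.height = q.height) : p = q :=
  Prod.ext h₁ h₂

variable {G : Type*} [CommGroup G]

instance : CommGroup (IntExtension G) := inferInstanceAs (CommGroup (G × Multiplicative ℤ))

/-- The inclusion of `G` in `G × ℤ` as the subgroup of elements with integer part zero. -/
def inl (G : Type*) [CommGroup G] : G →* IntExtension G := MonoidHom.inl G (Multiplicative ℤ)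

@[simp] theorem inl_fst (g : G) : (inl G g).1 = g := rfl
@[simp] theorem height_inl (g : G) : (inl G g).height = 0 := rfl
@[simp] theorem one_fst : (1 : IntExtension G).1 = 1 := rfl
@[simp] theorem height_one : (1 : IntExtension G).height = 0 := rfl
@[simp] theorem mul_fst (p q : IntExtension G) : (p * q).1 = p.1 * q.1 := rfl
@[simp] theorem height_mul (p q : IntExtension G) : (p * q).height = p.height + q.height := rfl
@[simp] theorem inv_fst (p : IntExtension G) : p⁻¹.1 = p.1⁻¹ := rfl
@[simp] theorem height_inv (p : IntExtension G) : p⁻¹.height = -p.height := rfl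

variable [TopologicalSpace G]

/-- The lexicographic topology on `G × ℤ`: a neighborhood of `(g, n)` contains `(h, n)` for all
`h` near `g`, and all of `G × {m}` for every `m > n`. It is neither Hausdorff nor invariant under
inversion. -/
@[reducible]
def lexTopology (G : Type*) [CommGroup G] [TopologicalSpace G] :
    TopologicalSpace (IntExtension G) where
  IsOpen O := ∀ p ∈ O, (∀ᶠ g in 𝓝 p.1, ((g, p.2) : IntExtension G) ∈ O) ∧
    ∀ q : IntExtension G, p.height < q.height → q ∈ O
  isOpen_univ _ _ := ⟨Filter.Eventually.of_forall fun _ => trivial, fun _ _ => trivial⟩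
  isOpen_inter _ _ h₁ h₂ p hp := ⟨(h₁ p hp.1).1.and (h₂ p hp.2).1,
    fun q hq => ⟨(h₁ p hp.1).2 q hq, (h₂ p hp.2).2 q hq⟩⟩
  isOpen_sUnion S hS := by
    rintro p ⟨O, hO, hp⟩
    exact ⟨(hS O hO p hp).1.mono fun g hg => ⟨O, hO, hg⟩,
      fun q hq => ⟨O, hO, (hS O hO p hp).2 q hq⟩⟩

/-- The basic lexicographic neighborhood determined by a subset `U` of `G` and a height `n`. -/
def lexSet (U : Set G) (n : ℤ) : Set (IntExtension G) :=
  {p | (p.height = n ∧ p.1 ∈ U) ∨ n < p.height}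

theorem isOpen_lexSet {U : Set G} (hU : IsOpen U) (n : ℤ) :
    IsOpen[lexTopology G] (lexSet U n) := by
  rintro p (⟨hp, hpU⟩ | hp)
  · exact ⟨Filter.mem_of_superset (hU.mem_nhds hpU) fun g hg => Or.inl ⟨hp, hg⟩,
      fun q hq => Or.inr (hp ▸ hq)⟩
  · exact ⟨Filter.Eventually.of_forall fun g => Or.inr hp, fun q hq => Or.inr (hp.trans hq)⟩

theorem nhds_lexTopology_hasBasis (p : IntExtension G) :
    (@nhds _ (lexTopology G) p).HasBasis (fun U : Set G => IsOpen U ∧ p.1 ∈ U)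
      (fun U => lexSet U p.height) := by
  let := lexTopology G
  refine ⟨fun s => ⟨fun hs => ?_, ?_⟩⟩
  · obtain ⟨O, hOs, hO, hp⟩ := mem_nhds_iff.1 hs
    obtain ⟨U, hUO, hU, hpU⟩ := mem_nhds_iff.1 (hO p hp).1
    refine ⟨U, ⟨hU, hpU⟩, ?_⟩
    rintro q (⟨hq, hqU⟩ | hq)
    · have : q = (q.1, p.2) := ext rfl hq
      exact hOs (this ▸ hUO hqU)
    · exact hOs ((hO p hp).2 q hq)
  · rintro ⟨U, ⟨hU, hp⟩, hUs⟩
    exact Filter.mem_of_superset ((isOpen_lexSet hU _).mem_nhds (Or.inl ⟨rfl, hp⟩)) hUs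

theorem continuousMul_lexTopology [ContinuousMul G] :
    @ContinuousMul (IntExtension G) (lexTopology G) _ := by
  let := lexTopology G
  refine ⟨continuous_iff_continuousAt.2 fun ⟨p, q⟩ => ?_⟩
  rw [ContinuousAt, nhds_prod_eq, ((nhds_lexTopology_hasBasis p).prod
    (nhds_lexTopology_hasBasis q)).tendsto_iff (nhds_lexTopology_hasBasis _)]
  rintro W ⟨hW, hpq⟩
  obtain ⟨U, V, hU, hV, hpU, hqV, hUV⟩ := isOpen_prod_iff.1 (hW.preimage continuous_mul) p.1 q.1 hpq
  refine ⟨(U, V), ⟨⟨hU, hpU⟩, hV, hqV⟩, ?_⟩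
  rintro ⟨p', q'⟩ ⟨hp', hq'⟩
  simp only [lexSet, Set.mem_ofPred_eq, height_mul, mul_fst] at hp' hq' ⊢
  rcases hp' with ⟨hp', hp'U⟩ | hp' <;> rcases hq' with ⟨hq', hq'V⟩ | hq'
  · exact Or.inl ⟨by omega, hUV (Set.mk_mem_prod hp'U hq'V)⟩
  all_goals exact Or.inr (by omega)

theorem isInducing_inl_lexTopology : @Topology.IsInducing _ _ _ (lexTopology G) (inl G) := by
  let := lexTopology G
  refine Topology.isInducing_iff_nhds.2 fun g => ?_
  refine (nhds_basis_opens g).ext ((nhds_lexTopology_hasBasis (inl G g)).comap (inl G))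
    (fun U hU => ⟨U, ⟨hU.2, hU.1⟩, ?_⟩) (fun U hU => ⟨U, ⟨hU.2, hU.1⟩, ?_⟩)
  · rintro h (⟨-, hh⟩ | hh)
    · exact hh
    · exact absurd hh (lt_irrefl _)
  · exact fun h hh => Or.inl ⟨rfl, hh⟩

end IntExtension

open IntExtension in
/-- Intersecting a Hausdorff group topology on `G × ℤ` with the lexicographic topology restores the
topology of `G` and keeps the points of negative height in the closure of `G`. -/
theorem IsHClosedGroup.notMem_closure_range_inl {G : Type u} [CommGroup G] [TopologicalSpace G]
    [ContinuousMul G] [T2Space G] (hG : IsHClosedGroup G)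
    (σ : TopologicalSpace (IntExtension G)) [@ContinuousMul _ σ _] [@T2Space _ σ]
    (hσ : Continuous[_, σ] (inl G)) {p : IntExtension G} (hp : p.height < 0) :
    p ∉ closure[σ] (Set.range (inl G)) := by
  intro hcl
  let ρ : TopologicalSpace (IntExtension G) := σ ⊓ lexTopology G
  have hmul : @ContinuousMul _ ρ _ := continuousMul_inf ‹_› continuousMul_lexTopology
  have hT2 : @T2Space _ ρ :=
    @T2Space.of_injective_continuous _ _ ρ σ _ id Function.injective_id
      (continuous_id_iff_le.2 inf_le_left)
  have hind : Topology.IsInducing (inl G) := by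
    refine ⟨?_⟩
    rw [induced_inf, ← @Topology.IsInducing.eq_induced _ _ _ (lexTopology G) _
      isInducing_inl_lexTopology]
    exact (inf_eq_right.2 (continuous_iff_le_induced.1 hσ)).symm
  have hclosed := hG (IntExtension G) (inl G) ⟨hind, fun g h hgh => congrArg Prod.fst hgh⟩
  -- Lexicographic neighborhoods of a point of negative height contain all of `G`.
  have hmem : p ∈ closure (Set.range (inl G)) := by
    refine mem_closure_iff_nhds.2 fun s hs => ?_
    rw [@nhds_inf _ σ (lexTopology G), Filter.mem_inf_iff] at hs
    obtain ⟨s₁, hs₁, s₂, hs₂, rfl⟩ := hs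
    obtain ⟨U, -, hU⟩ := (nhds_lexTopology_hasBasis p).mem_iff.1 hs₂
    obtain ⟨_, hq, g, rfl⟩ := (@mem_closure_iff_nhds _ σ _ _).1 hcl s₁ hs₁
    exact ⟨inl G g, ⟨hq, hU (Or.inr hp)⟩, g, rfl⟩
  rw [hclosed.closure_eq] at hmem
  obtain ⟨g, rfl⟩ := hmem
  exact lt_irrefl _ hp

/-! ### The group topology determined by a dissociated sequence -/

namespace IntExtension

variable {G : Type*} [CommGroup G]

/-- The basic neighborhood, determined by `V ⊆ G` and `k : ℕ`, of the unit in the group topology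
on `G × ℤ` that makes the sequence `(x ^ b i, 1)` converge to the unit: the products of an element
of `V` with finitely many powers `(x ^ b i, 1) ^ m i` such that `k * |m i| ≤ i`. -/
def sequenceNhd (x : G) (b : ℕ → ℤ) (V : Set G) (k : ℕ) : Set (IntExtension G) :=
  {p | ∃ m : ℕ →₀ ℤ, (∀ i, k * |m i| ≤ i) ∧ p.1 / x ^ Finsupp.linearCombination ℤ b m ∈ V ∧
    p.height = Finsupp.linearCombination ℤ (fun _ => (1 : ℤ)) m}

theorem sequenceNhd_mono (x : G) (b : ℕ → ℤ) {V W : Set G} (hVW : V ⊆ W) {k l : ℕ} (hkl : k ≤ l) :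
    sequenceNhd x b V l ⊆ sequenceNhd x b W k := by
  rintro p ⟨m, hm, hp, hh⟩
  exact ⟨m, fun i => (by gcongr : (k : ℤ) * |m i| ≤ l * |m i|).trans (hm i), hVW hp, hh⟩

variable [TopologicalSpace G]

/-- The neighborhoods `sequenceNhd x b V k` define a group topology. -/
@[reducible]
def sequenceBasis [IsTopologicalGroup G] (x : G) (b : ℕ → ℤ) :
    GroupFilterBasis (IntExtension G) :=
  groupFilterBasisOfComm {W | ∃ V ∈ 𝓝 (1 : G), ∃ k, 1 ≤ k ∧ W = sequenceNhd x b V k}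
    ⟨_, Set.univ, Filter.univ_mem, 1, le_rfl, rfl⟩
    (by
      rintro _ _ ⟨V, hV, k, hk, rfl⟩ ⟨W, hW, l, hl, rfl⟩
      exact ⟨_, ⟨V ∩ W, Filter.inter_mem hV hW, max k l, le_max_of_le_left hk, rfl⟩,
        Set.subset_inter (sequenceNhd_mono x b Set.inter_subset_left (le_max_left _ _))
          (sequenceNhd_mono x b Set.inter_subset_right (le_max_right _ _))⟩)
    (by
      rintro _ ⟨V, hV, k, hk, rfl⟩
      exact ⟨0, by simp, by simpa using mem_of_mem_nhds hV, by simp⟩)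
    (by
      rintro _ ⟨V, hV, k, hk, rfl⟩
      obtain ⟨W, hW, hWV⟩ := exists_nhds_one_split hV
      refine ⟨_, ⟨W, hW, 2 * k, by omega, rfl⟩, ?_⟩
      rintro _ ⟨p, ⟨m, hm, hp, hph⟩, q, ⟨n, hn, hq, hqh⟩, rfl⟩
      refine ⟨m + n, fun i => ?_, ?_, by simp [hph, hqh]⟩
      · have h₁ := hm i
        have h₂ := hn i
        push_cast at h₁ h₂
        have h₃ : (k : ℤ) * |m i + n i| ≤ k * (|m i| + |n i|) := by
          gcongr
          exact abs_add_le _ _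
        simp only [Finsupp.add_apply]
        linarith
      · rw [map_add, zpow_add, mul_fst, mul_div_mul_comm]
        exact hWV _ hp _ hq)
    (by
      rintro _ ⟨V, hV, k, hk, rfl⟩
      refine ⟨_, ⟨V⁻¹, inv_mem_nhds_one G hV, k, hk, rfl⟩, ?_⟩
      rintro p ⟨m, hm, hp, hph⟩
      refine ⟨-m, fun i => by simpa using hm i, ?_, by simp [hph]⟩
      rw [map_neg, zpow_neg, inv_fst, ← inv_div_inv, inv_inv, inv_inv, ← inv_div]
      simpa [div_eq_mul_inv, mul_comm] using hp)

theorem sequenceNhd_mem_sequenceBasis [IsTopologicalGroup G] (x : G) (b : ℕ → ℤ) {V : Set G}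
    (hV : V ∈ 𝓝 1) {k : ℕ} (hk : 1 ≤ k) : sequenceNhd x b V k ∈ sequenceBasis x b :=
  ⟨V, hV, k, hk, rfl⟩

/-- Dissociation makes the exponents of a point of `sequenceNhd x b V 1` unique for small `V`.
Hence a point whose exponents are nonzero is excluded by increasing `k`, and a point whose exponents
are all zero is excluded by shrinking `V`. -/
theorem t2Space_sequenceBasis [IsTopologicalGroup G] [T2Space G] {x : G} {b : ℕ → ℤ} {U : Set G}
    (hU : U ∈ 𝓝 1) (hb : IsDissociated b {n | x ^ n ∈ U}) :
    @T2Space _ (sequenceBasis x b).topology := by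
  let := (sequenceBasis x b).topology
  have := (sequenceBasis x b).isTopologicalGroup
  refine IsTopologicalGroup.t2Space_of_one_sep fun p hp => ?_
  obtain ⟨V, hV, hVU⟩ := exists_nhds_split_inv hU
  have huniq : ∀ m n : ℕ →₀ ℤ, (∀ i, |m i| ≤ i) → (∀ i, |n i| ≤ i) →
      p.1 / x ^ Finsupp.linearCombination ℤ b m ∈ V →
      p.1 / x ^ Finsupp.linearCombination ℤ b n ∈ V → m = n := by
    intro m n hm hn hpm hpn
    refine (sub_eq_zero.1 (hb (n - m) (fun i => ?_) ?_)).symm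
    · have := abs_sub (n i) (m i)
      have := hm i
      have := hn i
      simp only [Finsupp.sub_apply]
      linarith
    · have := hVU _ hpm _ hpn
      rw [div_div_div_cancel_left] at this
      simpa [zpow_sub, div_eq_mul_inv] using this
  by_cases hpV : p ∈ sequenceNhd x b V 1
  · obtain ⟨m, hm, hpm, hph⟩ := hpV
    simp only [Nat.cast_one, one_mul] at hm
    by_cases hm0 : m = 0
    · subst hm0
      have hp1 : (1 : G) ≠ p.1 := fun h => hp (ext h.symm (by simpa using hph))
      refine ⟨_, (sequenceBasis x b).mem_nhds_one (sequenceNhd_mem_sequenceBasis x b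
        (Filter.inter_mem hV (isOpen_ne.mem_nhds hp1)) le_rfl), ?_⟩
      rintro ⟨n, hn, hpn, -⟩
      obtain rfl := huniq n 0 (by simpa using hn) hm hpn.1 hpm
      exact hpn.2 (by simp)
    · obtain ⟨i, hi⟩ := Finsupp.ne_iff.1 hm0
      refine ⟨_, (sequenceBasis x b).mem_nhds_one (sequenceNhd_mem_sequenceBasis x b
        hV (Nat.le_add_left 1 i)), ?_⟩
      rintro ⟨n, hn, hpn, -⟩
      obtain rfl := huniq n m (fun j => (le_mul_of_one_le_left (abs_nonneg _)
        (by push_cast; omega)).trans (hn j)) hm hpn hpm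
      -- A nonzero exponent `n i` violates the bound `(i + 1) * |n i| ≤ i`.
      have h₁ : 1 ≤ |n i| := Int.one_le_abs hi
      have h₂ := hn i
      push_cast at h₂
      nlinarith
  · exact ⟨_, (sequenceBasis x b).mem_nhds_one (sequenceNhd_mem_sequenceBasis x b hV le_rfl), hpV⟩

theorem continuous_inl_sequenceBasis [IsTopologicalGroup G] (x : G) (b : ℕ → ℤ) :
    Continuous[_, (sequenceBasis x b).topology] (inl G) := by
  let := (sequenceBasis x b).topology
  have := (sequenceBasis x b).isTopologicalGroup
  refine continuous_of_continuousAt_one (inl G) ?_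
  rw [ContinuousAt, map_one, (sequenceBasis x b).nhds_one_hasBasis.tendsto_right_iff]
  rintro _ ⟨V, hV, k, hk, rfl⟩
  filter_upwards [hV] with g hg
  exact ⟨0, by simp, by simpa using hg, by simp⟩

/-- The elements `x ^ b i` of `G` converge to `(1, -1)`, since `(x ^ b i, 1)` tends to the unit. -/
theorem mem_closure_range_inl_sequenceBasis [IsTopologicalGroup G] (x : G) (b : ℕ → ℤ)
    {p : IntExtension G} (hp : p.1 = 1) (hph : p.height = -1) :
    p ∈ closure[(sequenceBasis x b).topology] (Set.range (inl G)) := by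
  let := (sequenceBasis x b).topology
  refine mem_closure_iff_nhds.2 fun s hs => ?_
  obtain ⟨_, ⟨V, hV, k, hk, rfl⟩, hs⟩ := ((sequenceBasis x b).nhds_hasBasis p).mem_iff.1 hs
  refine ⟨inl G (x ^ b k), hs ⟨(x ^ b k, Multiplicative.ofAdd 1), ⟨Finsupp.single k 1, fun i => ?_,
    by simpa using mem_of_mem_nhds hV, by simp [height]⟩, ?_⟩, _, rfl⟩
  · by_cases h : k = i
    · simp [h]
    · simp [Finsupp.single_eq_of_ne' h]
  · exact ext ((congrArg (· * x ^ b k) hp).trans (one_mul _)) (congrArg (· + 1) hph)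

end IntExtension

/-- Cyclic subgroups of an H-closed abelian topological group are precompact. -/
theorem IsHClosedGroup.exists_finite_zpowers_subset {G : Type u} [CommGroup G] [TopologicalSpace G]
    [IsTopologicalGroup G] [T2Space G] (hG : IsHClosedGroup G) (x : G) {U : Set G}
    (hU : U ∈ 𝓝 1) : ∃ K : Set G, K.Finite ∧ (Subgroup.zpowers x : Set G) ⊆ K * U := by
  by_contra! hcon
  obtain ⟨V, hV, hVU⟩ := exists_nhds_split_inv hU
  obtain ⟨W, hW, hWV⟩ := exists_nhds_split_inv hV
  have hsparse : IsSparse {n : ℤ | x ^ n ∈ W} := fun K hK hKu => by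
    refine hcon ((fun n : ℤ => x ^ n) '' K) (hK.image _) ?_
    rintro _ ⟨n, rfl⟩
    obtain ⟨k, hk, _, ⟨_, ⟨p, hp, q, hq, rfl⟩, _, ⟨r, hr, s, hs, rfl⟩, rfl⟩, rfl⟩ :=
      hKu ▸ Set.mem_univ n
    refine ⟨_, ⟨k, hk, rfl⟩, _, hVU _ (hWV _ hp _ hq) _ (hWV _ hr _ hs), ?_⟩
    simp only [← zpow_add, div_eq_mul_inv, ← zpow_neg]
    congr 1
  obtain ⟨b, hb⟩ := hsparse.exists_isDissociated
  have := (IntExtension.sequenceBasis x b).isTopologicalGroup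
  have hT2 := IntExtension.t2Space_sequenceBasis hW hb
  exact @IsHClosedGroup.notMem_closure_range_inl _ _ _ _ _ hG
    (IntExtension.sequenceBasis x b).topology
    (@IsTopologicalGroup.toContinuousMul _ (_) _ this) hT2
    (IntExtension.continuous_inl_sequenceBasis x b) (1, Multiplicative.ofAdd (-1))
    (by simp [IntExtension.height]) (IntExtension.mem_closure_range_inl_sequenceBasis x b rfl rfl)

/-! ### Completeness and compactness -/

/-- An H-closed abelian topological group is closed in its completion. -/
theorem IsHClosedGroup.completeSpace {G : Type u} [CommGroup G] [UniformSpace G] [IsUniformGroup G]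
    [T2Space G] (hG : IsHClosedGroup G) : CompleteSpace G := by
  have : IsUniformAddGroup (Additive G) := ⟨uniformContinuous_div (α := G)⟩
  have : T0Space (Additive G) := inferInstanceAs (T0Space G)
  have : T2Space (Multiplicative (UniformSpace.Completion (Additive G))) :=
    inferInstanceAs (T2Space (UniformSpace.Completion (Additive G)))
  have : CompleteSpace (Multiplicative (UniformSpace.Completion (Additive G))) :=
    inferInstanceAs (CompleteSpace (UniformSpace.Completion (Additive G)))
  let f : G →* Multiplicative (UniformSpace.Completion (Additive G)) :=
    AddMonoidHom.toMultiplicativeRight (UniformSpace.Completion.toCompl (α := Additive G))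
  have hf : IsUniformEmbedding f :=
    UniformSpace.Completion.isUniformEmbedding_coe (Additive G)
  have hcl := hG _ f hf.isEmbedding
  exact (completeSpace_iff_isComplete_range hf.isUniformInducing).2 hcl.isComplete

theorem IsHClosedGroup.isCompact_closure_zpowers {G : Type u} [CommGroup G] [TopologicalSpace G]
    [IsTopologicalGroup G] [T2Space G] (hG : IsHClosedGroup G) (x : G) :
    IsCompact (closure (Subgroup.zpowers x : Set G)) := by
  let : UniformSpace G := IsTopologicalGroup.rightUniformSpace G
  have : IsUniformGroup G := isUniformGroup_of_commGroup
  have := hG.completeSpace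
  refine isCompact_iff_totallyBounded_isComplete.2 ⟨TotallyBounded.closure
    (totallyBounded_iff_subset_finite_iUnion_nhds_one.2 fun U hU => ?_),
    isClosed_closure.isComplete⟩
  obtain ⟨K, hK, hKU⟩ := hG.exists_finite_zpowers_subset x hU
  exact ⟨K, hK, hKU.trans_eq (by rw [← smul_eq_mul, ← Set.iUnion_smul_set])⟩

theorem isPrecompactGroup_of_compactSpace (X : Type*) [Group X] [TopologicalSpace X]
    [IsTopologicalGroup X] [CompactSpace X] : IsPrecompactGroup X := by
  intro U hU
  obtain ⟨t, -, ht⟩ := isCompact_univ.elim_nhds_subcover (fun x : X => x • U)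
    (fun x _ => by simpa using smul_mem_nhds_smul x hU)
  exact ⟨t, t.finite_toSet, Set.univ_subset_iff.1 (ht.trans_eq
    (by
      rw [← smul_eq_mul, ← Set.iUnion_smul_set]
      rfl))⟩

theorem isRajkovCompleteGroup_of_compactSpace (X : Type*) [Group X] [TopologicalSpace X]
    [IsTopologicalGroup X] [h : CompactSpace X] : IsRajkovCompleteGroup X := by
  have htop : (upperUniformSpace X).toTopologicalSpace = ‹TopologicalSpace X› :=
    UniformSpace.toTopologicalSpace_inf.trans (inf_idem _)
  have hcompact : @CompactSpace X (upperUniformSpace X).toTopologicalSpace := by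
    rw [htop]
    exact h
  exact @complete_of_compact X (upperUniformSpace X) hcompact

theorem mainTheorem4 (G : Type u) [CommGroup G] [TopologicalSpace G] [IsTopologicalGroup G]
    [T2Space G] (hG : IsHClosedGroup G) :
    (∃ S : Set (Subgroup G), (∀ K ∈ S, IsCompact (K : Set G)) ∧
      (⋃ K ∈ S, (K : Set G)) = Set.univ) ∧
    (∀ X : Subgroup G, IsClosed (X : Set G) → IsMonotheticGroup X →
      IsPrecompactGroup X ∧ IsRajkovCompleteGroup X ∧ IsCompact (X : Set G)) := by
  refine ⟨⟨Set.range fun x : G => (Subgroup.zpowers x).topologicalClosure, ?_, ?_⟩, ?_⟩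
  · rintro _ ⟨x, rfl⟩
    exact hG.isCompact_closure_zpowers x
  · refine Set.eq_univ_of_forall fun x => Set.mem_iUnion₂.2 ⟨_, ⟨x, rfl⟩, ?_⟩
    exact subset_closure (Subgroup.mem_zpowers x)
  · rintro X hX ⟨x, hx⟩
    have hsub : (X : Set G) ⊆ closure (Subgroup.zpowers (x : G) : Set G) := by
      intro y hy
      have h := image_closure_subset_closure_image continuous_subtype_val
        (Set.mem_image_of_mem Subtype.val (hx ⟨y, hy⟩))
      refine closure_mono ?_ h
      rintro _ ⟨_, ⟨n, rfl⟩, rfl⟩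
      exact ⟨n, by simp⟩
    have hc : IsCompact (X : Set G) :=
      (hG.isCompact_closure_zpowers (x : G)).of_isClosed_subset hX hsub
    have : CompactSpace X := isCompact_iff_compactSpace.1 hc
    exact ⟨isPrecompactGroup_of_compactSpace X, isRajkovCompleteGroup_of_compactSpace X, hc⟩
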